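/- **Theorem 3.3.** Fix $p_0\in(0,1)$, $\lambda_{\mathrm{on}},\lambda_{\mathrm{off}}>0$ and $T>0$. For each $N\ge 1$ consider the dynamic Erdős–Rényi graph on the vertices $1,\dots,N$ (self-loops allowed) over the time interval $[0,T]$, whose $N(N+1)/2$ potential edges $\{i,j\}$, $i\le j$, evolve independently as follows. At time $0$ each edge is present with probability $p_0$ and absent with probability $1-p_0$; afterwards, independently of the initial state, it alternates between being present and being absent, where the on-times are exponentially distributed with rate $\lambda_{\mathrm{on}}$, the off-times are exponentially distributed with rate $\lambda_{\mathrm{off}}$, and all these durations are independent. Let $A_N(t)=(a_{i,j}(t))_{i,j=1}^N$ be the symmetric adjacency matrix at time $t$ (so $a_{i,j}(t)=1$ if the edge $\{i,j\}$ is present at time $t$, and $a_{i,j}(t)=0$ otherwise), and let $\mu_N(t)$ be its principal (largest) eigenvalue. Let $p(t):=\mathbb P(a_{i,j}(t)=1)$ for $t\in[0,T]$, which depends neither on $i,j$ nor on $N$. Then, for all $N\ge1$ and $t\in[0,T]$, $\mu_N(t)$ is integrable and $$\mathbb E[\mu_N(t)] = N\,p(t) + (1-p(t)) + \frac{\overline{\mathcal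 G}_N(t)}{N},$$ for some deterministic functions $\overline{\mathcal G}_N:[0,T]\to\mathbb R$ such that $$\limsup_{N\to\infty}\ \sup_{t\in[0,T]}\bigl|\overline{\mathcal G}_N(t)\bigr|<\infty .$$ -/

import Mathlib

open MeasureTheory ProbabilityTheory Filter
open scoped ENNReal

namespace DynamicER

/-- Labels of the primitive random variables of the model on `N` vertices. The potential edges are
the unordered pairs of vertices, loops included (`Sym2 (Fin N)` has `N (N + 1) / 2` elements).
Each potential edge `e` has an initial state, a sequence of off-times and a sequence of on-times. -/
inductive Source (N : ℕ) : Type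
  | init (e : Sym2 (Fin N)) : Source N
  | off (e : Sym2 (Fin N)) (l : ℕ) : Source N
  | on (e : Sym2 (Fin N)) (l : ℕ) : Source N

/-- The law of each primitive variable: initial states are `1` with probability `p₀` and `0` with
probability `1 - p₀`; off-times are exponential with rate `lamOff`; on-times are exponential with
rate `lamOn`. -/
noncomputable def sourceLaw {N : ℕ} (p₀ lamOn lamOff : ℝ) : Source N → Measure ℝ
  | .init _ => ENNReal.ofReal p₀ • Measure.dirac 1 + ENNReal.ofReal (1 - p₀) • Measure.dirac 0
  | .off _ _ => expMeasure lamOff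
  | .on _ _ => expMeasure lamOn

/-- `X` is a family of primitive random variables of the model on `N` vertices: jointly
independent random variables with the prescribed laws. -/
structure IsDriving {N : ℕ} {Ω : Type*} [MeasurableSpace Ω] (p₀ lamOn lamOff : ℝ)
    (P : Measure Ω) (X : Source N → Ω → ℝ) : Prop where
  measurable : ∀ s, Measurable (X s)
  hasLaw : ∀ s, HasLaw (X s) (sourceLaw p₀ lamOn lamOff s) P
  indep : iIndepFun X P

/-- The duration of the first `k` on-off cycles of the edge `e`, for the realisation `x` of the
primitive variables. -/
noncomputable def cycleTime {N : ℕ} (x : Source N → ℝ) (e : Sym2 (Fin N)) (k : ℕ) : ℝ :=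
  (∑ l ∈ Finset.range k, x (.off e l)) + ∑ l ∈ Finset.range k, x (.on e l)

open Classical in
/-- The state at time `t` of the edge `e` (`1` for present, `0` for absent), for the realisation
`x` of the primitive variables. An edge that starts absent alternates off-time, on-time, off-time
and so on; an edge that starts present alternates on-time, off-time, on-time and so on. -/
noncomputable def edgeState {N : ℕ} (x : Source N → ℝ) (e : Sym2 (Fin N)) (t : ℝ) : ℝ :=
  if x (.init e) = 0 then
    if ∃ k : ℕ, t ∈ Set.Ico (cycleTime x e k) (cycleTime x e k + x (.off e k)) then 0 else 1
  else
    if ∃ k : ℕ, t ∈ Set.Ico (cycleTime x e k) (cycleTime x e k + x (.on e k)) then 1 else 0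

/-- The (symmetric) adjacency matrix of the graph at time `t`. -/
noncomputable def adjacency {N : ℕ} (x : Source N → ℝ) (t : ℝ) : Matrix (Fin N) (Fin N) ℝ :=
  Matrix.of fun i j => edgeState x s(i, j) t

/-- The principal (that is, largest) eigenvalue of a real symmetric matrix of size `N ≥ 1`. -/
noncomputable def principalEigenvalue {N : ℕ} (A : Matrix (Fin N) (Fin N) ℝ) : ℝ :=
  sSup {r : ℝ | Module.End.HasEigenvalue (Matrix.toLin' A) r}

end DynamicER

/-! At a fixed time the edges are independent Bernoulli variables with common success probability
`p`, so the adjacency matrix is `p f fᵀ + W`, with `f` the all-ones vector and `W` symmetric,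
centred, with entries in `[-1, 1]`. Put `θ = N p` and `M_k = ⟨f, W^k f⟩`. When `‖W‖ ≤ θ / 8`,
pairing the eigenvector equation with `f, W f, W² f, W³ f` gives `l ≈ θ + M₁/N + M₂/(Nθ) +
M₃/(Nθ²)`, with an error controlled by `M₁²` and `M₄` (`abs_eigenvalue_sub_expansion_le`).

No concentration inequality is needed. If `W` is not known to be small, the off-diagonal part of
`W²` is large, and a multiple of the sum of its fourth powers dominates the trivial bound on the
error. Adding that term gives an inequality valid for every realisation
(`abs_principalEigenvalue_sub_expansion_le`).

In expectation `M₁` vanishes, `M₂/(Nθ)` becomes exactly `1 - p`, and counting index coincidences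
bounds everything else by `C(δ)/N`, where `δ` is a lower bound for `p`
(`abs_integral_principalEigenvalue_sub_le`). An edge that starts present and whose first on-time
exceeds `T` stays present, so `δ = p₀ exp(-lamOn T)` works for all times at once (`le_edgeProb`). -/

namespace DynamicER

/-! ### Deterministic expansion of the top eigenvalue -/

/-- Eigenvalue equation scaled by `θ`: `m_k = ⟨f, W^k f⟩ / (n θ^k)`. Since `l - 1` is of order `|m1|
+ m2`, replacing the denominators by `1` costs a product of two such quantities, and `hm24` absorbs
`m2 ^ 2` into `m4`. -/
lemma abs_sub_expansion_le_of_scalar_equation {l m1 m2 m3 m4 r : ℝ} 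
    (hm2 : 0 ≤ m2) (hm3 : |m3| ≤ m2 / 8) (hm24 : m2 ^ 2 ≤ m4)
    (hm42 : m4 ≤ m2 / 64) (hl : 7 / 8 ≤ l) (hr : (l - 1 / 8) * |r| ≤ m4)
    (h : l = 1 + m1 / l + m2 / l ^ 2 + m3 / l ^ 3 + r / l ^ 3) :
    |l - 1 - m1 - m2 - m3| ≤ 16 * (m1 ^ 2 + m4) := by
  have hl0 : 0 < l := by linarith
  obtain ⟨u, hu⟩ : ∃ u, u = 1 / l := ⟨_, rfl⟩
  have hu0 : 0 < u := by rw [hu]; positivity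
  have hlu : l * u = 1 := by rw [hu]; field_simp
  have hu1 : u ≤ 8 / 7 := by
    rw [hu, div_le_iff₀ hl0]; linarith
  have hu2 : u ^ 2 ≤ 64 / 49 := by nlinarith
  have hu3 : u ^ 3 ≤ 512 / 343 := by nlinarith [pow_pos hu0 2]
  have hr' : |r| ≤ 4 / 3 * m4 := by nlinarith [abs_nonneg r]
  have h' : l = 1 + m1 * u + m2 * u ^ 2 + m3 * u ^ 3 + r * u ^ 3 := by
    conv_lhs => rw [h]
    rw [hu]; field_simp
  have key : ∀ {a b k : ℝ}, 0 ≤ b → b ≤ k → |a * b| ≤ |a| * k := fun {a b k} hb hk => by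
    rw [abs_mul, abs_of_nonneg hb]; exact mul_le_mul_of_nonneg_left hk (abs_nonneg a)
  have e1 := key (a := m1) hu0.le hu1
  have e2 := key (a := m2) (pow_pos hu0 2).le hu2
  have e3 := key (a := m3) (pow_pos hu0 3).le hu3
  have e4 := key (a := r) (pow_pos hu0 3).le hu3
  have a2 : |m2| = m2 := abs_of_nonneg hm2
  have hd : |l - 1| ≤ 2 * |m1| + 2 * m2 := by
    have : l - 1 = m1 * u + m2 * u ^ 2 + m3 * u ^ 3 + r * u ^ 3 := by linarith
    rw [this]
    have t1 := abs_add_le (m1 * u + m2 * u ^ 2 + m3 * u ^ 3) (r * u ^ 3)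
    have t2 := abs_add_le (m1 * u + m2 * u ^ 2) (m3 * u ^ 3)
    have t3 := abs_add_le (m1 * u) (m2 * u ^ 2)
    rw [a2] at e2
    linarith [abs_nonneg m1]
  have hu' : 1 - u = (l - 1) * u := by linear_combination -hlu
  -- Every `u ^ k - 1` contains the factor `1 - u = (l - 1) * u`, which makes the error quadratic
  -- apart from the `r` term.
  have hE : l - 1 - m1 - m2 - m3 = (l - 1) * (-(m1 * u) - m2 * (u * (1 + u))
      - m3 * (u * (1 + u + u ^ 2))) + r * u ^ 3 := by
    linear_combination h' + (-m1 - m2 * (1 + u) - m3 * (1 + u + u ^ 2)) * hu'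
  have f2 := key (a := m2) (b := u * (1 + u)) (k := 120 / 49) (by positivity) (by nlinarith)
  have f3 := key (a := m3) (b := u * (1 + u + u ^ 2)) (k := 4) (by positivity) (by nlinarith)
  have hB : |-(m1 * u) - m2 * (u * (1 + u)) - m3 * (u * (1 + u + u ^ 2))| ≤ 2 * |m1| + 3 * m2 := by
    have t1 := abs_sub (-(m1 * u) - m2 * (u * (1 + u))) (m3 * (u * (1 + u + u ^ 2)))
    have t2 := abs_sub (-(m1 * u)) (m2 * (u * (1 + u)))
    rw [abs_neg] at t2
    rw [a2] at f2
    linarith [abs_nonneg m1]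
  rw [hE]
  refine (abs_add_le _ _).trans ?_
  rw [abs_mul]
  have := mul_le_mul hd hB (abs_nonneg _) (by positivity)
  have sq : |m1| ^ 2 = m1 ^ 2 := sq_abs m1
  nlinarith [sq_nonneg (|m1| - m2), abs_nonneg m1]

section InnerProductSpace

variable {E : Type*} [NormedAddCommGroup E] [InnerProductSpace ℝ E]

/-- The top eigenvalue of a rank-one matrix `p f fᵀ` perturbed by a small symmetric `W`, expanded
to third order. -/
theorem abs_eigenvalue_sub_expansion_le {W : E →ₗ[ℝ] E} (hW : W.IsSymmetric) {f v : E}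
    {n p l : ℝ} (hn : 0 < n) (hf : ‖f‖ ^ 2 = n) (hp : 0 < p)
    (hnorm : ∀ x, ‖W x‖ ≤ n * p / 8 * ‖x‖)
    (hv : v ≠ 0) (hlv : (p * inner ℝ f v) • f + W v = l • v)
    (hl : n * p + inner ℝ f (W f) / n ≤ l) :
    |l - n * p - inner ℝ f (W f) / n - inner ℝ f (W (W f)) / n / (n * p)
        - inner ℝ f (W (W (W f))) / n / (n * p) ^ 2|
      ≤ 16 * ((inner ℝ f (W f) / n) ^ 2 / (n * p)
        + inner ℝ f (W (W (W (W f)))) / n / (n * p) ^ 3) := by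
  have hff : inner ℝ f f = n := by rw [real_inner_self_eq_norm_sq, hf]
  set θ := n * p with hθ
  have hθ0 : 0 < θ := by positivity
  set c := θ / 8 with hc
  have hc0 : 0 < c := by positivity
  have bnd : ∀ x y : E, |inner ℝ x (W y)| ≤ c * (‖x‖ * ‖y‖) := fun x y => by
    refine (abs_real_inner_le_norm x (W y)).trans ?_
    nlinarith [hnorm y, norm_nonneg x, mul_le_mul_of_nonneg_left (hnorm y) (norm_nonneg x)]
  have M2 : inner ℝ f (W (W f)) = ‖W f‖ ^ 2 := by
    rw [← hW, real_inner_self_eq_norm_sq]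
  have M3 : inner ℝ f (W (W (W f))) = inner ℝ (W f) (W (W f)) := by
    rw [← hW]
  have M4 : inner ℝ f (W (W (W (W f)))) = ‖W (W f)‖ ^ 2 := by
    rw [← hW, ← hW, real_inner_self_eq_norm_sq]
  have b1 : |inner ℝ f (W f)| ≤ c * n := by
    have := bnd f f
    rwa [← sq, hf] at this
  have hlc : 7 / 8 * θ ≤ l := by
    have : -c ≤ inner ℝ f (W f) / n := by
      rw [le_div_iff₀ hn]; linarith [neg_abs_le (inner ℝ f (W f))]
    linarith
  have hl0 : 0 < l := by linarith
  -- Otherwise `v` would be an eigenvector of `W` with eigenvalue `l ≥ 7θ/8`, beyond its norm bound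
  -- `θ/8`.
  have hg : inner ℝ f v ≠ 0 := by
    intro h0
    rw [h0] at hlv
    simp only [mul_zero, zero_smul, zero_add] at hlv
    have := hnorm v
    rw [hlv, norm_smul, Real.norm_of_nonneg hl0.le] at this
    have hv' := norm_pos_iff.2 hv
    nlinarith
  obtain ⟨w, hw1, hw⟩ : ∃ w : E, inner ℝ f w = n ∧ l • w = θ • f + W w := by
    refine ⟨(n / inner ℝ f v) • v, ?_, ?_⟩
    · rw [inner_smul_right]; field_simp
    · rw [smul_comm, ← hlv, smul_add, smul_smul, map_smul]
      congr 2
      field_simp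
      linarith
  -- Each use moves one `W` from the unknown `w` to a known vector; after four uses only `⟨W⁴ f, w⟩`
  -- still involves `w`.
  have hrec (y : E) : l * inner ℝ y w = θ * inner ℝ y f + inner ℝ (W y) w := by
    rw [hW, ← inner_smul_right, hw, inner_add_right, inner_smul_right]
  have r0 := hrec f
  have r1 := hrec (W f)
  have r2 := hrec (W (W f))
  have r3 := hrec (W (W (W f)))
  rw [hw1, hff] at r0
  rw [hW f f] at r1
  rw [hW (W f) f, real_inner_self_eq_norm_sq] at r2
  rw [hW (W (W f)) f, real_inner_comm (W f)] at r3
  -- Two factors `W` go back to `w`. Applying `W²` to the equation of `w` gives `(l - c) ‖W² w‖ ≤ θ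
  -- ‖W² f‖`, so the remainder is bounded by the fourth moment.
  have r4 : |inner ℝ (W (W (W (W f)))) w| * (l - c) ≤ θ * ‖W (W f)‖ ^ 2 := by
    rw [hW, hW]
    have h1 : l • W (W w) = θ • W (W f) + W (W (W w)) := by
      rw [← map_smul, ← map_smul, hw]; simp
    have h2 : l * ‖W (W w)‖ ≤ θ * ‖W (W f)‖ + c * ‖W (W w)‖ := by
      calc l * ‖W (W w)‖ = ‖l • W (W w)‖ := by rw [norm_smul, Real.norm_of_nonneg hl0.le]
        _ ≤ ‖θ • W (W f)‖ + ‖W (W (W w))‖ := by rw [h1]; exact norm_add_le _ _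
        _ ≤ _ := by
          rw [norm_smul, Real.norm_of_nonneg hθ0.le]
          gcongr
          exact hnorm _
    have h3 := abs_real_inner_le_norm (W (W f)) (W (W w))
    calc _ ≤ ‖W (W f)‖ * ‖W (W w)‖ * (l - c) :=
          mul_le_mul_of_nonneg_right h3 (by linarith)
      _ = ‖W (W f)‖ * (l * ‖W (W w)‖ - c * ‖W (W w)‖) := by ring
      _ ≤ ‖W (W f)‖ * (θ * ‖W (W f)‖) := by gcongr; linarith
      _ = _ := by ring
  set A := inner ℝ (W (W (W (W f)))) w
  have b2 : ‖W f‖ ^ 2 ≤ c ^ 2 * n := by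
    rw [← hf, ← mul_pow]; exact pow_le_pow_left₀ (norm_nonneg _) (hnorm f) 2
  have b3 : |inner ℝ (W f) (W (W f))| ≤ c * ‖W f‖ ^ 2 := by
    have := bnd (W f) (W f)
    rwa [← sq] at this
  have b4 : ‖W (W f)‖ ^ 2 ≤ c ^ 2 * ‖W f‖ ^ 2 := by
    rw [← mul_pow]; exact pow_le_pow_left₀ (norm_nonneg _) (hnorm _) 2
  have b24 : (‖W f‖ ^ 2) ^ 2 ≤ n * ‖W (W f)‖ ^ 2 := by
    rw [← M2, ← hf, ← mul_pow, ← sq_abs]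
    exact pow_le_pow_left₀ (abs_nonneg _) (abs_real_inner_le_norm _ _) 2
  rw [M2, M3, M4]
  have key := abs_sub_expansion_le_of_scalar_equation (l := l / θ)
    (m1 := inner ℝ f (W f) / n / θ) (m2 := ‖W f‖ ^ 2 / n / θ ^ 2)
    (m3 := inner ℝ (W f) (W (W f)) / n / θ ^ 3) (m4 := ‖W (W f)‖ ^ 2 / n / θ ^ 4)
    (r := A / n / θ ^ 4) ?_ ?_ ?_ ?_ ?_ ?_ ?_
  · have e : l - θ - inner ℝ f (W f) / n - ‖W f‖ ^ 2 / n / θ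
        - inner ℝ (W f) (W (W f)) / n / θ ^ 2 = θ * (l / θ - 1 - inner ℝ f (W f) / n / θ
        - ‖W f‖ ^ 2 / n / θ ^ 2 - inner ℝ (W f) (W (W f)) / n / θ ^ 3) := by
      field_simp
    rw [e, abs_mul, abs_of_pos hθ0]
    refine (mul_le_mul_of_nonneg_left key hθ0.le).trans_eq ?_
    field_simp
  · positivity
  · rw [abs_div, abs_div, abs_of_pos hn, abs_of_pos (pow_pos hθ0 3), div_div,
      div_le_iff₀ (by positivity)]
    refine b3.trans_eq ?_
    rw [hc]; field_simp
  · rw [div_div, div_div, div_pow, div_le_div_iff₀ (by positivity) (by positivity)]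
    calc _ ≤ n * ‖W (W f)‖ ^ 2 * (n * θ ^ 4) := by gcongr
      _ = _ := by ring
  · rw [div_div, div_div, div_div, div_le_div_iff₀ (by positivity) (by positivity)]
    calc _ ≤ c ^ 2 * ‖W f‖ ^ 2 * (n * (θ ^ 2 * 64)) := by gcongr
      _ = _ := by rw [hc]; ring
  · rw [le_div_iff₀ hθ0]; exact hlc
  · rw [abs_div, abs_div, abs_of_pos hn, abs_of_pos (pow_pos hθ0 4)]
    calc _ = (|A| * (l - c)) / (n * θ ^ 5) := by rw [hc]; field_simp
      _ ≤ θ * ‖W (W f)‖ ^ 2 / (n * θ ^ 5) := by gcongr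
      _ = _ := by field_simp
  · have hln := hl0.ne'
    field_simp at r0 r1 r2 r3 ⊢
    linear_combination l ^ 3 * r0 + l ^ 2 * r1 + l * r2 + r3

end InnerProductSpace

/-! ### The largest eigenvalue of a symmetric matrix -/

section PrincipalEigenvalue

variable {N : ℕ}

lemma toEuclideanLin_apply_coord (A : Matrix (Fin N) (Fin N) ℝ) (x : EuclideanSpace ℝ (Fin N))
    (i : Fin N) : A.toEuclideanLin x i = ∑ j, A i j * x j := rfl

lemma hasEigenvalue_toEuclideanLin_iff (A : Matrix (Fin N) (Fin N) ℝ) (r : ℝ) :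
    Module.End.HasEigenvalue A.toEuclideanLin r ↔ Module.End.HasEigenvalue (Matrix.toLin' A) r := by
  constructor
  · intro h
    obtain ⟨v, hv⟩ := h.exists_hasEigenvector
    refine Module.End.hasEigenvalue_of_hasEigenvector (x := v.ofLp)
      ⟨Module.End.mem_eigenspace_iff.2 ?_, fun h0 => hv.2 (by ext i; simp [h0])⟩
    ext i
    exact congrArg (fun w : EuclideanSpace ℝ (Fin N) => w i) hv.apply_eq_smul
  · intro h
    obtain ⟨v, hv⟩ := h.exists_hasEigenvector
    refine Module.End.hasEigenvalue_of_hasEigenvector (x := WithLp.toLp 2 v)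
      ⟨Module.End.mem_eigenspace_iff.2 ?_, fun h0 => hv.2 (by simpa using h0)⟩
    ext i
    exact congrFun hv.apply_eq_smul i

variable {A : Matrix (Fin N) (Fin N) ℝ}

lemma isSymmetric_toEuclideanLin (hA : A.IsSymm) : A.toEuclideanLin.IsSymmetric :=
  Matrix.isSymmetric_toEuclideanLin_iff.2 (by
    rw [Matrix.IsHermitian, Matrix.conjTranspose_eq_transpose_of_trivial, hA.eq])

/-- The spectrum is finite, and nonempty because the supremum of the Rayleigh quotient is an
eigenvalue, so the defining supremum is attained. -/
theorem hasEigenvalue_principalEigenvalue (hN : 0 < N) (hA : A.IsSymm) :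
    Module.End.HasEigenvalue A.toEuclideanLin (principalEigenvalue A) := by
  have : NeZero N := ⟨hN.ne'⟩
  have hS : A.toEuclideanLin.IsSymmetric := isSymmetric_toEuclideanLin hA
  have hne := hS.hasEigenvalue_iSup_of_finiteDimensional
  rw [hasEigenvalue_toEuclideanLin_iff] at hne ⊢
  exact Set.Nonempty.csSup_mem ⟨_, hne⟩ (Module.End.finite_hasEigenvalue _)

theorem inner_toEuclideanLin_le (hN : 0 < N) (hA : A.IsSymm) (x : EuclideanSpace ℝ (Fin N)) :
    inner ℝ x (A.toEuclideanLin x) ≤ principalEigenvalue A * ‖x‖ ^ 2 := by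
  have : NeZero N := ⟨hN.ne'⟩
  have hS : A.toEuclideanLin.IsSymmetric := isSymmetric_toEuclideanLin hA
  have hne := hS.hasEigenvalue_iSup_of_finiteDimensional
  rw [hasEigenvalue_toEuclideanLin_iff] at hne
  have hle := le_csSup (Module.End.finite_hasEigenvalue _).bddAbove hne
  rcases eq_or_ne x 0 with rfl | hx
  · simp
  have hx0 : 0 < ‖x‖ := norm_pos_iff.2 hx
  rw [← div_le_iff₀ (by positivity)]
  refine le_trans ?_ hle
  -- A real supremum bounds its members only when the range is bounded above; the operator norm
  -- provides the bound.
  have hb : BddAbove (Set.range fun y : {y : EuclideanSpace ℝ (Fin N) // y ≠ 0} =>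
      RCLike.re (inner ℝ (A.toEuclideanLin y) (y : EuclideanSpace ℝ (Fin N)))
        / ‖(y : EuclideanSpace ℝ (Fin N))‖ ^ 2) := by
    refine ⟨‖A.toEuclideanLin.toContinuousLinearMap‖, ?_⟩
    rintro _ ⟨⟨y, hy⟩, rfl⟩
    have hy0 : 0 < ‖y‖ := norm_pos_iff.2 hy
    simp only [RCLike.re_to_real]
    rw [div_le_iff₀ (by positivity)]
    refine (real_inner_le_norm _ _).trans ?_
    have := A.toEuclideanLin.toContinuousLinearMap.le_opNorm y
    rw [LinearMap.coe_toContinuousLinearMap'] at this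
    nlinarith
  have := le_ciSup hb ⟨x, hx⟩
  rw [real_inner_comm]
  simpa using this

end PrincipalEigenvalue

/-! ### Norm bounds for matrices with entries in `[-1, 1]` -/

section Norms

variable {N : ℕ}

lemma norm_sq_toEuclideanLin_le (M : Matrix (Fin N) (Fin N) ℝ) (x : EuclideanSpace ℝ (Fin N)) :
    ‖M.toEuclideanLin x‖ ^ 2 ≤ (∑ i, ∑ j, M i j ^ 2) * ‖x‖ ^ 2 := by
  simp only [EuclideanSpace.real_norm_sq_eq, toEuclideanLin_apply_coord, Finset.sum_mul]
  refine Finset.sum_le_sum fun i _ => ?_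
  exact (Finset.sum_mul_sq_le_sq_mul_sq _ _ _).trans_eq (Finset.sum_mul ..)

lemma norm_toEuclideanLin_le_of_abs_le_one {M : Matrix (Fin N) (Fin N) ℝ}
    (hM : ∀ i j, |M i j| ≤ 1) (x : EuclideanSpace ℝ (Fin N)) :
    ‖M.toEuclideanLin x‖ ≤ N * ‖x‖ := by
  refine (sq_le_sq₀ (norm_nonneg _) (by positivity)).1 ?_
  refine (norm_sq_toEuclideanLin_le M x).trans ?_
  rw [mul_pow]
  gcongr
  calc ∑ i, ∑ j, M i j ^ 2 ≤ ∑ i : Fin N, ∑ j : Fin N, (1 : ℝ) := by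
        gcongr with i _ j _
        exact (sq_le_one_iff_abs_le_one _).2 (hM i j)
    _ = _ := by simp [sq]

/-- The operator norm of `W²` is controlled by its diagonal and the Frobenius norm of its
off-diagonal part. -/
lemma norm_toEuclideanLin_toEuclideanLin_le {W : Matrix (Fin N) (Fin N) ℝ}
    (hW : ∀ i j, |W i j| ≤ 1) (x : EuclideanSpace ℝ (Fin N)) {F : ℝ}
    (hF : ∑ i, ∑ j, (if i = j then 0 else ∑ k, W i k * W k j) ^ 2 ≤ F ^ 2) (hF0 : 0 ≤ F) :
    ‖W.toEuclideanLin (W.toEuclideanLin x)‖ ≤ (N + F) * ‖x‖ := by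
  set O : Matrix (Fin N) (Fin N) ℝ := Matrix.of fun i j => if i = j then 0 else ∑ k, W i k * W k j
  set D : Matrix (Fin N) (Fin N) ℝ := Matrix.diagonal fun i => ∑ k, W i k * W k i
  have hdec : W.toEuclideanLin (W.toEuclideanLin x) = D.toEuclideanLin x + O.toEuclideanLin x := by
    have : W * W = D + O := by
      ext i j
      by_cases h : i = j
      · subst h; simp [D, O, Matrix.mul_apply]
      · simp [D, O, h, Matrix.mul_apply]
    rw [← LinearMap.add_apply, ← map_add, ← this]
    ext i
    simp only [toEuclideanLin_apply_coord, Matrix.mul_apply, Finset.mul_sum, Finset.sum_mul]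
    rw [Finset.sum_comm]
    simp only [mul_assoc]
  rw [hdec, add_mul]
  refine (norm_add_le _ _).trans (add_le_add ?_ ?_)
  · refine (sq_le_sq₀ (norm_nonneg _) (by positivity)).1 ?_
    rw [mul_pow]
    simp only [EuclideanSpace.real_norm_sq_eq, Finset.mul_sum]
    refine Finset.sum_le_sum fun i _ => ?_
    have : D.toEuclideanLin x i = (∑ k, W i k * W k i) * x i := by
      simp [toEuclideanLin_apply_coord, D, Matrix.diagonal_apply]
    rw [this, mul_pow]
    gcongr ?_ * _
    rw [sq_le_sq, Nat.abs_cast]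
    refine (Finset.abs_sum_le_sum_abs _ _).trans ?_
    calc _ ≤ ∑ k : Fin N, (1 : ℝ) := by
          gcongr with k _
          rw [abs_mul]
          exact mul_le_one₀ (hW _ _) (abs_nonneg _) (hW _ _)
      _ = _ := by simp
  · refine (sq_le_sq₀ (norm_nonneg _) (by positivity)).1 ?_
    refine (norm_sq_toEuclideanLin_le O x).trans ?_
    rw [mul_pow]
    gcongr
    exact hF

end Norms

/-! ### The expansion for every realisation -/

section Expansion

variable {N : ℕ}

/-- Crude fallback for the case where `W` may be large: each of the five terms is at most `n / δ ^
2`. -/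
lemma abs_sub_expansion_le_of_norm_le {E : Type*} [NormedAddCommGroup E] [InnerProductSpace ℝ E]
    {L : E →ₗ[ℝ] E} {f : E} {n p δ l : ℝ} (hN0 : 0 < n) (hff : ‖f‖ ^ 2 = n) (hδ : 0 < δ)
    (hδp : δ ≤ p) (hp : p ≤ 1) (hLn : ∀ x, ‖L x‖ ≤ n * ‖x‖) (hl : |l| ≤ n) :
    |l - n * p - inner ℝ f (L f) / n - inner ℝ f (L (L f)) / n / (n * p)
        - inner ℝ f (L (L (L f))) / n / (n * p) ^ 2| ≤ 5 * (n / δ ^ 2) := by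
  have hp0 : 0 < p := hδ.trans_le hδp
  have hδ1 : δ ≤ 1 := hδp.trans hp
  have hi (x : E) {c : ℝ} (hx : ‖x‖ ≤ c * ‖f‖) :
      |inner ℝ f x| / n ≤ c := by
    rw [div_le_iff₀ hN0, ← hff]
    refine (abs_real_inner_le_norm f x).trans ?_
    nlinarith [norm_nonneg f]
  have n1 := hLn f
  have n2 : ‖L (L f)‖ ≤ n ^ 2 * ‖f‖ := (hLn _).trans (by nlinarith)
  have n3 : ‖L (L (L f))‖ ≤ n ^ 3 * ‖f‖ := (hLn _).trans (by nlinarith)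
  have hδ2 : (1 : ℝ) ≤ 1 / δ ^ 2 := by
    rw [le_div_iff₀ (by positivity), one_mul]; exact pow_le_one₀ hδ.le hδ1
  have hNδ2 : n ≤ n / δ ^ 2 := by
    rw [div_eq_mul_one_div]; exact le_mul_of_one_le_right hN0.le hδ2
  have b1 : |inner ℝ f (L f) / n| ≤ n / δ ^ 2 := by
    rw [abs_div, abs_of_pos hN0]; exact (hi _ n1).trans hNδ2
  have b0 : |n * p| ≤ n / δ ^ 2 := by
    rw [abs_of_pos (by positivity)]
    exact (mul_le_of_le_one_right hN0.le hp).trans hNδ2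
  have b2 : |inner ℝ f (L (L f)) / n / (n * p)| ≤ n / δ ^ 2 := by
    rw [abs_div, abs_div, abs_of_pos hN0, abs_of_pos (by positivity : 0 < n * p),
      div_le_iff₀ (by positivity)]
    refine (hi _ n2).trans ?_
    calc n ^ 2 = n / δ ^ 2 * (n * δ ^ 2) := by field_simp
      _ ≤ _ := by
        gcongr
        exact (by nlinarith : δ ^ 2 ≤ δ).trans hδp
  have b3 : |inner ℝ f (L (L (L f))) / n / (n * p) ^ 2| ≤ n / δ ^ 2 := by
    rw [abs_div, abs_div, abs_of_pos hN0, abs_of_pos (by positivity : 0 < (n * p) ^ 2),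
      div_le_iff₀ (by positivity)]
    refine (hi _ n3).trans ?_
    calc n ^ 3 = n / δ ^ 2 * (n * δ) ^ 2 := by field_simp
      _ ≤ _ := by gcongr
  have t4 := abs_sub (l - n * p - inner ℝ f (L f) / n - inner ℝ f (L (L f)) / n / (n * p))
    (inner ℝ f (L (L (L f))) / n / (n * p) ^ 2)
  have t3 := abs_sub (l - n * p - inner ℝ f (L f) / n) (inner ℝ f (L (L f)) / n / (n * p))
  have t2 := abs_sub (l - n * p) (inner ℝ f (L f) / n)
  have t1 := abs_sub l (n * p)
  linarith

/-- The last term is Markov's inequality in pointwise form: it pays for the realisations in which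
the perturbative expansion is unavailable, so that afterwards only moments have to be estimated. -/
theorem abs_principalEigenvalue_sub_expansion_le (hN : 0 < N) {δ p : ℝ} (hδ : 0 < δ) (hδp : δ ≤ p)
    (hp : p ≤ 1) (hNδ : 128 ≤ δ ^ 2 * N) {W A : Matrix (Fin N) (Fin N) ℝ} (hWs : W.IsSymm)
    (hW : ∀ i j, |W i j| ≤ 1) (hAW : ∀ i j, A i j = p + W i j) (hA : ∀ i j, |A i j| ≤ 1) :
    |principalEigenvalue A - N * p - (∑ i, ∑ j, W i j) / N
        - (∑ i, ∑ j, ∑ k, W i j * W j k) / N / (N * p)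
        - (∑ i, ∑ j, ∑ k, ∑ l, W i j * (W j k * W k l)) / N / (N * p) ^ 2|
      ≤ 16 * (((∑ i, ∑ j, W i j) / N) ^ 2 / (N * p)
        + (∑ i, ∑ j, ∑ k, ∑ l, ∑ m, W i j * (W j k * (W k l * W l m))) / N / (N * p) ^ 3)
        + 5 * 2 ^ 28 / δ ^ 10
          * ((∑ i, ∑ j, (if i = j then 0 else ∑ k, W i k * W k j) ^ 4) / N ^ 5) := by
  have hN0 : (0 : ℝ) < N := Nat.cast_pos.2 hN
  have hp0 : 0 < p := hδ.trans_le hδp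
  have hδ1 : δ ≤ 1 := hδp.trans hp
  have hAs : A.IsSymm := by
    ext i j
    rw [Matrix.transpose_apply, hAW, hAW, hWs.apply]
  have hWS : W.toEuclideanLin.IsSymmetric := isSymmetric_toEuclideanLin hWs
  set L := W.toEuclideanLin with hL
  set f : EuclideanSpace ℝ (Fin N) := WithLp.toLp 2 1 with hf
  have hinner (x : EuclideanSpace ℝ (Fin N)) : inner ℝ f x = ∑ i, x i := by
    simp [PiLp.inner_apply, hf]
  have hff : ‖f‖ ^ 2 = N := by rw [EuclideanSpace.real_norm_sq_eq]; simp [hf]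
  have hLapp (x : EuclideanSpace ℝ (Fin N)) (i : Fin N) : L x i = ∑ j, W i j * x j := rfl
  have hf1 (i : Fin N) : f i = 1 := rfl
  have hAL (x : EuclideanSpace ℝ (Fin N)) : A.toEuclideanLin x = (p * inner ℝ f x) • f + L x := by
    ext i
    have : A.toEuclideanLin x i = ∑ j, A i j * x j := rfl
    rw [this, PiLp.add_apply, PiLp.smul_apply, hf1, hLapp, hinner]
    simp [hAW, add_mul, Finset.sum_add_distrib, Finset.mul_sum]
  have M1 : ∑ i, ∑ j, W i j = inner ℝ f (L f) := by
    simp [hinner, hLapp, hf1]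
  have M2 : ∑ i, ∑ j, ∑ k, W i j * W j k = inner ℝ f (L (L f)) := by
    simp [hinner, hLapp, hf1, Finset.mul_sum]
  have M3 : ∑ i, ∑ j, ∑ k, ∑ l, W i j * (W j k * W k l) = inner ℝ f (L (L (L f))) := by
    simp [hinner, hLapp, hf1, Finset.mul_sum]
  have M4 : ∑ i, ∑ j, ∑ k, ∑ l, ∑ m, W i j * (W j k * (W k l * W l m))
      = inner ℝ f (L (L (L (L f)))) := by
    simp [hinner, hLapp, hf1, Finset.mul_sum]
  have P4 : 0 ≤ inner ℝ f (L (L (L (L f)))) := by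
    rw [← hWS, ← hWS]; exact real_inner_self_nonneg
  rw [M1, M2, M3, M4]
  set l := principalEigenvalue A
  set G := ∑ i, ∑ j, (if i = j then 0 else ∑ k, W i k * W k j) ^ 4
  set F := ∑ i, ∑ j, (if i = j then 0 else ∑ k, W i k * W k j) ^ 2
  have hG0 : 0 ≤ G := Finset.sum_nonneg fun i _ => Finset.sum_nonneg fun j _ => by positivity
  have hF0 : 0 ≤ F := Finset.sum_nonneg fun i _ => Finset.sum_nonneg fun j _ => by positivity
  -- Cauchy–Schwarz over the `N ^ 2` index pairs.
  have hFG : F ^ 2 ≤ N ^ 2 * G := by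
    have e1 : F = ∑ q : Fin N × Fin N,
        (if q.1 = q.2 then 0 else ∑ k, W q.1 k * W k q.2) ^ 2 := by
      rw [Fintype.sum_prod_type]
    have e2 : G = ∑ q : Fin N × Fin N,
        ((if q.1 = q.2 then 0 else ∑ k, W q.1 k * W k q.2) ^ 2) ^ 2 := by
      rw [Fintype.sum_prod_type]
      simp only [G, ← pow_mul]
    rw [e1, e2]
    refine sq_sum_le_card_mul_sum_sq.trans_eq ?_
    simp [sq]
  obtain ⟨v, hv⟩ := (hasEigenvalue_principalEigenvalue hN hAs).exists_hasEigenvector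
  have hlv := hv.apply_eq_smul
  -- With this threshold the off-diagonal part of `W²` has norm at most `δ²N²/128`. The diagonal
  -- contributes at most `N ≤ δ²N²/128` by `hNδ`, whence `‖W‖ ≤ δN/8 ≤ Np/8`.
  by_cases hFs : F ≤ (δ ^ 2 * N ^ 2 / 128) ^ 2
  · have hsq (x : EuclideanSpace ℝ (Fin N)) : ‖L x‖ ≤ N * p / 8 * ‖x‖ := by
      have h1 := norm_toEuclideanLin_toEuclideanLin_le hW x hFs (by positivity)
      rw [← hL] at h1
      have h2 : ‖L x‖ ^ 2 ≤ ‖x‖ * ‖L (L x)‖ := by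
        rw [← real_inner_self_eq_norm_sq, hWS]
        exact real_inner_le_norm _ _
      refine (sq_le_sq₀ (norm_nonneg _) (by positivity)).1 ?_
      calc ‖L x‖ ^ 2 ≤ ‖x‖ * ((N + δ ^ 2 * N ^ 2 / 128) * ‖x‖) := by
            refine h2.trans ?_
            gcongr
        _ ≤ ‖x‖ * ((δ ^ 2 * N ^ 2 / 64) * ‖x‖) := by
            gcongr
            nlinarith
        _ ≤ ‖x‖ * ((p ^ 2 * N ^ 2 / 64) * ‖x‖) := by gcongr
        _ = _ := by ring
    have hray := inner_toEuclideanLin_le hN hAs f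
    rw [hAL, inner_add_right, inner_smul_right, real_inner_self_eq_norm_sq, hff] at hray
    have key := abs_eigenvalue_sub_expansion_le hWS hN0 hff hp0 hsq hv.2 (by rw [← hAL, hlv]) (by
      refine le_of_mul_le_mul_right (le_trans (le_of_eq ?_) hray) hN0
      field_simp)
    refine key.trans (le_add_of_nonneg_right (by positivity))
  · push Not at hFs
    have hLn (x : EuclideanSpace ℝ (Fin N)) : ‖L x‖ ≤ N * ‖x‖ :=
      norm_toEuclideanLin_le_of_abs_le_one hW x
    have hl : |l| ≤ N := by
      have := norm_toEuclideanLin_le_of_abs_le_one hA v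
      rw [hlv, norm_smul, Real.norm_eq_abs] at this
      exact le_of_mul_le_mul_right this (norm_pos_iff.2 hv.2)
    -- The factor `2 ^ 28` is `128 ^ 4`, from the fourth power of the threshold.
    have hmain : 5 * (N / δ ^ 2) ≤ 5 * 2 ^ 28 / δ ^ 10 * (G / N ^ 5) := by
      have h1 : ((δ ^ 2 * N ^ 2 / 128) ^ 2) ^ 2 ≤ N ^ 2 * G :=
        (pow_le_pow_left₀ (by positivity) hFs.le 2).trans hFG
      calc 5 * (N / δ ^ 2) = 5 * 2 ^ 28 / (δ ^ 10 * N ^ 7) * ((δ ^ 2 * N ^ 2 / 128) ^ 2) ^ 2 := by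
            field_simp; norm_num
        _ ≤ 5 * 2 ^ 28 / (δ ^ 10 * N ^ 7) * (N ^ 2 * G) := by gcongr
        _ = _ := by field_simp
    exact (abs_sub_expansion_le_of_norm_le hN0 hff hδ hδp hp hLn hl).trans
      (hmain.trans (le_add_of_nonneg_left (by positivity)))

end Expansion

/-! ### Mixed moments of independent centred variables -/

section Moments

variable {Ω ι : Type*} {Y : ι → Ω → ℝ}

lemma abs_list_prod_map_le_one (hb : ∀ e ω, |Y e ω| ≤ 1) (l : List ι) (ω : Ω) :
    |(l.map fun e => Y e ω).prod| ≤ 1 := by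
  induction l with
  | nil => simp
  | cons a l ih =>
    simp only [List.map_cons, List.prod_cons, abs_mul]
    exact mul_le_one₀ (hb a ω) (abs_nonneg _) ih

variable [MeasurableSpace Ω] {P : Measure Ω}

lemma measurable_list_prod_map (hY : ∀ e, Measurable (Y e)) (l : List ι) :
    Measurable fun ω => (l.map fun e => Y e ω).prod := by
  induction l with
  | nil => simp
  | cons a l ih =>
    simp only [List.map_cons, List.prod_cons]
    exact (hY a).mul ih

section Vanishing

variable [DecidableEq ι]

/-- A mixed moment of independent centred variables vanishes if some factor is simple. -/
theorem integral_list_prod_map_eq_zero (hY : ∀ e, Measurable (Y e)) (hi : iIndepFun Y P)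
    (h0 : ∀ e, ∫ ω, Y e ω ∂P = 0) {l : List ι} (e : ι) (he : l.count e = 1) :
    ∫ ω, (l.map fun e => Y e ω).prod ∂P = 0 := by
  have hmem : e ∈ l := List.count_pos_iff.1 (by omega)
  have hperm := List.perm_cons_erase hmem
  set l' := l.erase e with hl'
  have hnot : e ∉ l' := by
    rw [← List.count_eq_zero, hl', List.count_erase_self, he]
  have hcongr : (fun ω => (l.map fun e => Y e ω).prod)
      = fun ω => Y e ω * (l'.map fun e => Y e ω).prod := by
    funext ω
    rw [(hperm.map _).prod_eq, List.map_cons, List.prod_cons]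
  have hfin := hi.indepFun_finset {e} l'.toFinset (by simpa using hnot) hY
  have hind : IndepFun (Y e) (fun ω => (l'.map fun e => Y e ω).prod) P := by
    -- The remaining product, repetitions included, is a function of the variables indexed by
    -- `l'.toFinset`, which does not contain `e`.
    have h2 : Measurable fun z : l'.toFinset → ℝ =>
        (l'.attach.map fun a => z ⟨a.1, List.mem_toFinset.2 a.2⟩).prod := by
      exact measurable_list_prod_map
        (Y := fun (a : {a // a ∈ l'}) (z : l'.toFinset → ℝ) => z ⟨a.1, List.mem_toFinset.2 a.2⟩)
        (fun a => measurable_pi_apply _) l'.attach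
    have h1 : Measurable fun z : ({e} : Finset ι) → ℝ => z ⟨e, Finset.mem_singleton_self e⟩ :=
      measurable_pi_apply _
    have := hfin.comp h1 h2
    have hatt (ω : Ω) : (l'.map fun e => Y e ω).prod
        = (l'.attach.map fun a => Y a.1 ω).prod := by
      conv_lhs => rw [← List.attach_map_subtype_val l', List.map_map]
      rfl
    simp_rw [hatt]
    exact this
  rw [hcongr, hind.integral_fun_mul_eq_mul_integral (hY e).aestronglyMeasurable
    (measurable_list_prod_map hY l').aestronglyMeasurable, h0, zero_mul]

lemma integral_two_eq_zero (hY : ∀ e, Measurable (Y e)) (hi : iIndepFun Y P)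
    (h0 : ∀ e, ∫ ω, Y e ω ∂P = 0) (e₁ e₂ : ι) (h : e₁ ≠ e₂) :
    ∫ ω, ([e₁, e₂].map fun e => Y e ω).prod ∂P = 0 :=
  integral_list_prod_map_eq_zero hY hi h0 e₁ (by simp [h.symm])

lemma integral_three_eq_zero (hY : ∀ e, Measurable (Y e)) (hi : iIndepFun Y P)
    (h0 : ∀ e, ∫ ω, Y e ω ∂P = 0) (e₁ e₂ e₃ : ι) (h : ¬(e₁ = e₂ ∧ e₂ = e₃)) :
    ∫ ω, ([e₁, e₂, e₃].map fun e => Y e ω).prod ∂P = 0 := by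
  by_cases h12 : e₁ = e₂
  · exact integral_list_prod_map_eq_zero hY hi h0 e₃ (by grind)
  by_cases h13 : e₁ = e₃
  · exact integral_list_prod_map_eq_zero hY hi h0 e₂ (by grind)
  · exact integral_list_prod_map_eq_zero hY hi h0 e₁ (by grind)

lemma integral_four_eq_zero (hY : ∀ e, Measurable (Y e)) (hi : iIndepFun Y P)
    (h0 : ∀ e, ∫ ω, Y e ω ∂P = 0) (e₁ e₂ e₃ e₄ : ι)
    (h : ¬((e₁ = e₂ ∧ e₃ = e₄) ∨ (e₁ = e₃ ∧ e₂ = e₄) ∨ (e₁ = e₄ ∧ e₂ = e₃))) :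
    ∫ ω, ([e₁, e₂, e₃, e₄].map fun e => Y e ω).prod ∂P = 0 := by
  by_cases h1 : [e₁, e₂, e₃, e₄].count e₁ = 1
  · exact integral_list_prod_map_eq_zero hY hi h0 e₁ h1
  by_cases h2 : [e₁, e₂, e₃, e₄].count e₂ = 1
  · exact integral_list_prod_map_eq_zero hY hi h0 e₂ h2
  by_cases h3 : [e₁, e₂, e₃, e₄].count e₃ = 1
  · exact integral_list_prod_map_eq_zero hY hi h0 e₃ h3
  · exact integral_list_prod_map_eq_zero hY hi h0 e₄ (by grind)

end Vanishing

variable [IsProbabilityMeasure P]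

lemma integrable_list_prod_map (hY : ∀ e, Measurable (Y e)) (hb : ∀ e ω, |Y e ω| ≤ 1)
    (l : List ι) : Integrable (fun ω => (l.map fun e => Y e ω).prod) P :=
  Integrable.of_bound (measurable_list_prod_map hY l).aestronglyMeasurable 1
    (ae_of_all _ fun ω => abs_list_prod_map_le_one hb l ω)

lemma abs_integral_list_prod_map_le_one (hb : ∀ e ω, |Y e ω| ≤ 1) (l : List ι) :
    |∫ ω, (l.map fun e => Y e ω).prod ∂P| ≤ 1 := by
  have := norm_integral_le_of_norm_le_const (μ := P) (f := fun ω => (l.map fun e => Y e ω).prod) (C := 1)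
    (ae_of_all _ fun ω => abs_list_prod_map_le_one hb l ω)
  simpa using this

lemma integral_sum_list_prod_map {κ : Type*} [Fintype κ] (hY : ∀ e, Measurable (Y e))
    (hb : ∀ e ω, |Y e ω| ≤ 1) (l : κ → List ι) :
    ∫ ω, ∑ q, ((l q).map fun e => Y e ω).prod ∂P
      = ∑ q, ∫ ω, ((l q).map fun e => Y e ω).prod ∂P :=
  integral_finsetSum _ fun q _ => integrable_list_prod_map hY hb (l q)

end Moments

/-! ### Moments of walk sums, by counting index coincidences -/

section MatrixMoments

variable {N : ℕ} {Ω : Type*} [MeasurableSpace Ω] {P : Measure Ω}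
  {Y : Sym2 (Fin N) → Ω → ℝ}

/-- A vertex `a` visited once yields an edge used once: `s(i, a)` in general. If `a = j`, that edge
also arises from `b = i`, and the loop `s(j, j)` serves instead. -/
lemma integral_codegree_eq_zero (hY : ∀ e, Measurable (Y e)) (hi : iIndepFun Y P)
    (h0 : ∀ e, ∫ ω, Y e ω ∂P = 0) {i j : Fin N} (hij : i ≠ j) (k : List (Fin N)) (a : Fin N)
    (ha : k.count a = 1) :
    ∫ ω, ((k.flatMap fun b => [s(i, b), s(b, j)]).map fun e => Y e ω).prod ∂P = 0 := by
  have hc (e : Sym2 (Fin N)) (h : ∀ b, [s(i, b), s(b, j)].count e = if b = a then 1 else 0) :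
      (k.flatMap fun b => [s(i, b), s(b, j)]).count e = 1 := by
    rw [← ha]
    clear ha
    induction k with
    | nil => simp
    | cons b k ih =>
      rw [List.flatMap_cons, List.count_append, ih, h, List.count_cons, add_comm]
      simp
  by_cases haj : a = j
  · refine integral_list_prod_map_eq_zero hY hi h0 s(a, j) (hc _ fun b => ?_)
    subst haj
    simp only [List.count_cons, List.count_nil, beq_iff_eq, Sym2.eq_iff]
    grind
  · refine integral_list_prod_map_eq_zero hY hi h0 s(i, a) (hc _ fun b => ?_)
    simp only [List.count_cons, List.count_nil, beq_iff_eq, Sym2.eq_iff]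
    grind

variable [IsProbabilityMeasure P]

theorem integral_sum_entries (hY : ∀ e, Measurable (Y e)) (hb : ∀ e ω, |Y e ω| ≤ 1)
    (h0 : ∀ e, ∫ ω, Y e ω ∂P = 0) :
    ∫ ω, ∑ i, ∑ j, Y s(i, j) ω ∂P = 0 := by
  have := integral_sum_list_prod_map (P := P) hY hb fun q : Fin N × Fin N => [s(q.1, q.2)]
  simpa [Fintype.sum_prod_type, h0] using this

theorem integral_sq_sum_entries_le (hY : ∀ e, Measurable (Y e)) (hb : ∀ e ω, |Y e ω| ≤ 1)
    (hi : iIndepFun Y P) (h0 : ∀ e, ∫ ω, Y e ω ∂P = 0) :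
    ∫ ω, (∑ i, ∑ j, Y s(i, j) ω) ^ 2 ∂P ≤ 2 * (N : ℝ) ^ 2 := by
  have h := integral_sum_list_prod_map (P := P) hY hb
    fun q : Fin N × Fin N × Fin N × Fin N => [s(q.1, q.2.1), s(q.2.2.1, q.2.2.2)]
  simp only [Fintype.sum_prod_type] at h
  have e : ∀ ω, (∑ i, ∑ j, Y s(i, j) ω) ^ 2
      = ∑ i, ∑ j, ∑ k, ∑ l, ([s(i, j), s(k, l)].map fun e => Y e ω).prod := fun ω => by
    rw [sq]
    simp_rw [Finset.sum_mul, Finset.mul_sum]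
    simp
  simp_rw [e]
  rw [h]
  calc _ ≤ ∑ i : Fin N, ∑ j : Fin N, ∑ k : Fin N, ∑ l : Fin N,
        ((if i = k then if j = l then (1 : ℝ) else 0 else 0)
          + (if i = l then if j = k then (1 : ℝ) else 0 else 0)) := by
        gcongr with i _ j _ k _ l _
        have hle := le_of_abs_le
          (abs_integral_list_prod_map_le_one (P := P) hb [s(i, j), s(k, l)])
        by_cases he : s(i, j) = s(k, l)
        · rw [Sym2.eq_iff] at he
          refine hle.trans ?_
          rcases he with ⟨h1, h2⟩ | ⟨h1, h2⟩
          · simp [h1, h2]; split_ifs <;> norm_num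
          · simp [h1, h2]; split_ifs <;> norm_num
        · rw [integral_two_eq_zero hY hi h0 _ _ he]
          split_ifs <;> norm_num
    _ = _ := by
        simp [Finset.sum_add_distrib]; ring

/-- Only the walks `i, j, i` survive. This sum is the source of the term `1 - p`. -/
theorem integral_sum_walks_two (hY : ∀ e, Measurable (Y e)) (hb : ∀ e ω, |Y e ω| ≤ 1)
    (hi : iIndepFun Y P) (h0 : ∀ e, ∫ ω, Y e ω ∂P = 0) {v : ℝ}
    (hv : ∀ e, ∫ ω, Y e ω ^ 2 ∂P = v) :
    ∫ ω, ∑ i, ∑ j, ∑ k, Y s(i, j) ω * Y s(j, k) ω ∂P = N ^ 2 * v := by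
  have h := integral_sum_list_prod_map (P := P) hY hb
    fun q : Fin N × Fin N × Fin N => [s(q.1, q.2.1), s(q.2.1, q.2.2)]
  simp only [Fintype.sum_prod_type] at h
  have e : ∀ ω, ∑ i, ∑ j, ∑ k, Y s(i, j) ω * Y s(j, k) ω
      = ∑ i, ∑ j, ∑ k, ([s(i, j), s(j, k)].map fun e => Y e ω).prod := fun ω => by
    simp
  simp_rw [e]
  rw [h]
  calc _ = ∑ i : Fin N, ∑ j : Fin N, ∑ k : Fin N, (if i = k then v else 0) := by
        congr! 6 with i _ j _ k _
        split_ifs with hik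
        · subst hik
          rw [← hv s(i, j)]
          congr 1; funext ω
          simp [Sym2.eq_swap (a := j), sq]
        · refine integral_two_eq_zero hY hi h0 _ _ ?_
          rw [Ne, Sym2.eq_iff]
          grind
    _ = _ := by simp; ring

/-- All three edges must coincide, which leaves two free vertices. -/
theorem abs_integral_sum_walks_three_le (hY : ∀ e, Measurable (Y e)) (hb : ∀ e ω, |Y e ω| ≤ 1)
    (hi : iIndepFun Y P) (h0 : ∀ e, ∫ ω, Y e ω ∂P = 0) :
    |∫ ω, ∑ i, ∑ j, ∑ k, ∑ l, Y s(i, j) ω * (Y s(j, k) ω * Y s(k, l) ω) ∂P| ≤ N ^ 2 := by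
  have h := integral_sum_list_prod_map (P := P) hY hb
    fun q : Fin N × Fin N × Fin N × Fin N =>
      [s(q.1, q.2.1), s(q.2.1, q.2.2.1), s(q.2.2.1, q.2.2.2)]
  have e : ∀ ω, ∑ i, ∑ j, ∑ k, ∑ l, Y s(i, j) ω * (Y s(j, k) ω * Y s(k, l) ω)
      = ∑ q : Fin N × Fin N × Fin N × Fin N,
      ([s(q.1, q.2.1), s(q.2.1, q.2.2.1), s(q.2.2.1, q.2.2.2)].map fun e => Y e ω).prod :=
    fun ω => by simp [Fintype.sum_prod_type]
  simp_rw [e]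
  rw [h]
  refine (Finset.abs_sum_le_sum_abs _ _).trans ?_
  simp only [Fintype.sum_prod_type]
  calc _ ≤ ∑ i : Fin N, ∑ j : Fin N, ∑ k : Fin N, ∑ l : Fin N,
        (if i = k then if j = l then (1 : ℝ) else 0 else 0) := by
        gcongr with i _ j _ k _ l _
        by_cases hc : i = k ∧ j = l
        · simp only [hc.1, hc.2, if_true]
          exact abs_integral_list_prod_map_le_one hb _
        · rw [integral_three_eq_zero hY hi h0 _ _ _ (by simp only [Sym2.eq_iff]; grind), abs_zero]
          split_ifs <;> norm_num
    _ = _ := by simp; ring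

/-- The edges must match in pairs; each of the four resulting vertex patterns leaves three free
vertices. -/
theorem integral_sum_walks_four_le (hY : ∀ e, Measurable (Y e)) (hb : ∀ e ω, |Y e ω| ≤ 1)
    (hi : iIndepFun Y P) (h0 : ∀ e, ∫ ω, Y e ω ∂P = 0) :
    ∫ ω, ∑ i, ∑ j, ∑ k, ∑ l, ∑ m,
      Y s(i, j) ω * (Y s(j, k) ω * (Y s(k, l) ω * Y s(l, m) ω)) ∂P ≤ 4 * (N : ℝ) ^ 3 := by
  have h := integral_sum_list_prod_map (P := P) hY hb
    fun q : Fin N × Fin N × Fin N × Fin N × Fin N =>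
      [s(q.1, q.2.1), s(q.2.1, q.2.2.1), s(q.2.2.1, q.2.2.2.1), s(q.2.2.2.1, q.2.2.2.2)]
  simp only [Fintype.sum_prod_type] at h
  have e : ∀ ω, ∑ i, ∑ j, ∑ k, ∑ l, ∑ m,
        Y s(i, j) ω * (Y s(j, k) ω * (Y s(k, l) ω * Y s(l, m) ω))
      = ∑ i, ∑ j, ∑ k, ∑ l, ∑ m,
        ([s(i, j), s(j, k), s(k, l), s(l, m)].map fun e => Y e ω).prod :=
    fun ω => by simp
  simp_rw [e]
  rw [h]
  calc _ ≤ ∑ i : Fin N, ∑ j : Fin N, ∑ k : Fin N, ∑ l : Fin N, ∑ m : Fin N,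
        ((if i = k then if k = m then (1 : ℝ) else 0 else 0)
        + (if i = k then if j = l then (1 : ℝ) else 0 else 0)
        + (if i = l then if j = k then (1 : ℝ) else 0 else 0)
        + (if j = l then if i = m then (1 : ℝ) else 0 else 0)) := by
        gcongr with i _ j _ k _ l _ m _
        have hle := le_of_abs_le
          (abs_integral_list_prod_map_le_one (P := P) hb [s(i, j), s(j, k), s(k, l), s(l, m)])
        by_cases hc : (i = k ∧ k = m) ∨ (i = k ∧ j = l) ∨ (i = l ∧ j = k) ∨ (j = l ∧ i = m)
        · refine hle.trans ?_
          have (p q : Prop) [Decidable p] [Decidable q] :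
            (0 : ℝ) ≤ if p then if q then (1 : ℝ) else 0 else 0 := by split_ifs <;> norm_num
          have p1 := this (i = k) (k = m)
          have p2 := this (i = k) (j = l)
          have p3 := this (i = l) (j = k)
          have p4 := this (j = l) (i = m)
          rcases hc with hc | hc | hc | hc <;>
          · simp only [if_pos hc.1, if_pos hc.2] at *
            linarith
        · rw [integral_four_eq_zero hY hi h0 _ _ _ _ (by simp only [Sym2.eq_iff]; grind)]
          split_ifs <;> norm_num
    _ = _ := by
        simp [Finset.sum_add_distrib]; ring

/-- The four intermediate vertices must match in pairs, in one of three ways. The order `N²`,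
against the trivial `N⁴`, makes the fallback term `O(1/N)`. -/
theorem integral_pow_four_codegree_le (hY : ∀ e, Measurable (Y e)) (hb : ∀ e ω, |Y e ω| ≤ 1)
    (hi : iIndepFun Y P) (h0 : ∀ e, ∫ ω, Y e ω ∂P = 0) {i j : Fin N} (hij : i ≠ j) :
    ∫ ω, (∑ k, Y s(i, k) ω * Y s(k, j) ω) ^ 4 ∂P ≤ 3 * (N : ℝ) ^ 2 := by
  have h := integral_sum_list_prod_map (P := P) hY hb
    fun q : Fin N × Fin N × Fin N × Fin N =>
      [q.1, q.2.1, q.2.2.1, q.2.2.2].flatMap fun b => [s(i, b), s(b, j)]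
  simp only [Fintype.sum_prod_type] at h
  have e : ∀ ω, (∑ k, Y s(i, k) ω * Y s(k, j) ω) ^ 4
      = ∑ a, ∑ b, ∑ c, ∑ d,
        (([a, b, c, d].flatMap fun b => [s(i, b), s(b, j)]).map fun e => Y e ω).prod :=
    fun ω => by
      simp only [pow_succ, pow_zero, one_mul, Finset.sum_mul, Finset.mul_sum]
      refine Finset.sum_congr rfl fun a _ => Finset.sum_congr rfl fun b _ =>
        Finset.sum_congr rfl fun c _ => Finset.sum_congr rfl fun d _ => ?_
      simp
      ring
  simp_rw [e]
  rw [h]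
  calc _ ≤ ∑ a : Fin N, ∑ b : Fin N, ∑ c : Fin N, ∑ d : Fin N,
        ((if a = b then if c = d then (1 : ℝ) else 0 else 0)
        + (if a = c then if b = d then (1 : ℝ) else 0 else 0)
        + (if a = d then if b = c then (1 : ℝ) else 0 else 0)) := by
        gcongr with a _ b _ c _ d _
        have hle := le_of_abs_le (abs_integral_list_prod_map_le_one (P := P) hb
          ([a, b, c, d].flatMap fun b => [s(i, b), s(b, j)]))
        have hz := integral_codegree_eq_zero hY hi h0 hij [a, b, c, d]
        by_cases hc : (a = b ∧ c = d) ∨ (a = c ∧ b = d) ∨ (a = d ∧ b = c)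
        · refine hle.trans ?_
          have (p q : Prop) [Decidable p] [Decidable q] :
            (0 : ℝ) ≤ if p then if q then (1 : ℝ) else 0 else 0 := by split_ifs <;> norm_num
          have p1 := this (a = b) (c = d)
          have p2 := this (a = c) (b = d)
          have p3 := this (a = d) (b = c)
          rcases hc with hc | hc | hc <;>
          · simp only [if_pos hc.1, if_pos hc.2] at *
            linarith
        · have : ∃ x, [a, b, c, d].count x = 1 := by
            by_cases h1 : [a, b, c, d].count a = 1
            · exact ⟨_, h1⟩
            by_cases h2 : [a, b, c, d].count b = 1
            · exact ⟨_, h2⟩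
            by_cases h3 : [a, b, c, d].count c = 1
            · exact ⟨_, h3⟩
            · exact ⟨d, by grind⟩
          obtain ⟨x, hx⟩ := this
          rw [hz x hx]
          split_ifs <;> norm_num
    _ = _ := by
        simp [Finset.sum_add_distrib]; ring

end MatrixMoments

/-! ### Expected top eigenvalue of a symmetric Bernoulli matrix -/

section Bernoulli

variable {Ω : Type*} [MeasurableSpace Ω] {P : Measure Ω}

lemma integral_of_zero_one {f : Ω → ℝ} (hf : Measurable f) (h01 : ∀ ω, f ω = 0 ∨ f ω = 1) :
    ∫ ω, f ω ∂P = P.real {ω | f ω = 1} := by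
  rw [show {ω | f ω = 1} = f ⁻¹' {1} from rfl, ← integral_indicator_one (hf (measurableSet_singleton 1))]
  congr 1; funext ω
  rcases h01 ω with h | h <;> simp [Set.indicator, h]

variable [IsProbabilityMeasure P]

/-- The function factors through a finite Boolean cube, so `g` needs no measurability; in particular
it may be the principal eigenvalue. -/
lemma integrable_comp_of_zero_one {ι : Type*} [Finite ι] {b : ι → Ω → ℝ}
    (hb : ∀ e, Measurable (b e)) (h01 : ∀ e ω, b e ω = 0 ∨ b e ω = 1) (g : (ι → ℝ) → ℝ) :
    Integrable (fun ω => g fun e => b e ω) P := by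
  classical
  have hB : Measurable fun ω e => decide (b e ω = 1) :=
    measurable_pi_lambda _ fun e => measurable_to_bool (by
      convert hb e (measurableSet_singleton 1) using 1
      ext ω; simp)
  have hg : (fun ω => g fun e => b e ω)
      = (fun B : ι → Bool => g fun e => if B e then 1 else 0) ∘ fun ω e => decide (b e ω = 1) := by
    funext ω
    simp only [Function.comp]
    congr 1; funext e
    rcases h01 e ω with h | h <;> simp [h]
  rw [hg]
  obtain ⟨C, hC⟩ := (Set.finite_range fun B : ι → Bool => |g fun e => if B e then 1 else 0|).bddAbove
  exact Integrable.of_bound ((Measurable.of_discrete.comp hB).aestronglyMeasurable) C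
    (ae_of_all _ fun ω => hC ⟨_, rfl⟩)

variable {N : ℕ} {b : Sym2 (Fin N) → Ω → ℝ}

/-- The constant in the bound on the expected top eigenvalue of a symmetric Bernoulli matrix whose
edge probability is at least `δ`. -/
noncomputable def expansionConst (δ : ℝ) : ℝ :=
  1 / δ ^ 2 + 32 / δ + 64 / δ ^ 3 + 15 * 2 ^ 28 / δ ^ 10

/-- Integrates the pointwise expansion. The four summands of `expansionConst` come, in order, from
the third-order term, the squared first-order term, the walks of length four and the fallback term.
-/
theorem abs_integral_principalEigenvalue_sub_le (hN : 0 < N) {δ p : ℝ} (hδ : 0 < δ) (hδp : δ ≤ p)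
    (hNδ : 128 ≤ δ ^ 2 * N) (hb : ∀ e, Measurable (b e)) (hi : iIndepFun b P)
    (h01 : ∀ e ω, b e ω = 0 ∨ b e ω = 1) (hp : ∀ e, P.real {ω | b e ω = 1} = p) :
    |∫ ω, principalEigenvalue (Matrix.of fun i j => b s(i, j) ω) ∂P - N * p - (1 - p)|
      ≤ expansionConst δ / N := by
  have hN0 : (0 : ℝ) < N := Nat.cast_pos.2 hN
  have hp0 : 0 < p := hδ.trans_le hδp
  have hp1 : p ≤ 1 := by
    rw [← hp s(⟨0, hN⟩, ⟨0, hN⟩)]; exact measureReal_le_one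
  set Y : Sym2 (Fin N) → Ω → ℝ := fun e ω => b e ω - p with hYdef
  have hY : ∀ e, Measurable (Y e) := fun e => (hb e).sub_const p
  have hYi : iIndepFun Y P := hi.comp (fun _ x => x - p) fun _ => measurable_id.sub_const p
  have hI (g : (Sym2 (Fin N) → ℝ) → ℝ) : Integrable (fun ω => g fun e => b e ω) P :=
    integrable_comp_of_zero_one hb h01 g
  have hYb : ∀ e ω, |Y e ω| ≤ 1 := fun e ω => by
    rw [abs_le]
    rcases h01 e ω with h | h <;> constructor <;> simp only [hYdef, h] <;> linarith
  have hbint : ∀ e, ∫ ω, b e ω ∂P = p := fun e => by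
    rw [integral_of_zero_one (hb e) (h01 e), hp]
  have h0 : ∀ e, ∫ ω, Y e ω ∂P = 0 := fun e => by
    simp only [hYdef]
    rw [integral_sub (hI fun x => x e) (integrable_const p), hbint]
    simp
  have hv : ∀ e, ∫ ω, Y e ω ^ 2 ∂P = p * (1 - p) := fun e => by
    have : (fun ω => Y e ω ^ 2) = fun ω => (1 - 2 * p) * b e ω + p ^ 2 := by
      funext ω
      rcases h01 e ω with h | h <;> simp only [hYdef, h] <;> ring
    rw [this, integral_add ((hI fun x => x e).const_mul _) (integrable_const _),
      integral_const_mul, hbint]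
    simp
    ring
  set l : Ω → ℝ := fun ω => principalEigenvalue (Matrix.of fun i j => b s(i, j) ω)
  set S1 : Ω → ℝ := fun ω => ∑ i, ∑ j, Y s(i, j) ω
  set S2 : Ω → ℝ := fun ω => ∑ i, ∑ j, ∑ k, Y s(i, j) ω * Y s(j, k) ω
  set S3 : Ω → ℝ := fun ω => ∑ i, ∑ j, ∑ k, ∑ l, Y s(i, j) ω * (Y s(j, k) ω * Y s(k, l) ω)
  set S4 : Ω → ℝ := fun ω => ∑ i, ∑ j, ∑ k, ∑ l, ∑ m,
    Y s(i, j) ω * (Y s(j, k) ω * (Y s(k, l) ω * Y s(l, m) ω))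
  set S5 : Ω → ℝ := fun ω => ∑ i, ∑ j, (if i = j then 0 else ∑ k, Y s(i, k) ω * Y s(k, j) ω) ^ 4
  have il : Integrable l P := hI fun x => principalEigenvalue (Matrix.of fun i j => x s(i, j))
  have i1 : Integrable S1 P := hI fun x => ∑ i, ∑ j, (x s(i, j) - p)
  have i1' : Integrable (fun ω => S1 ω ^ 2) P := hI fun x => (∑ i, ∑ j, (x s(i, j) - p)) ^ 2
  have i2 : Integrable S2 P := hI fun x => ∑ i, ∑ j, ∑ k, (x s(i, j) - p) * (x s(j, k) - p)
  have i3 : Integrable S3 P := hI fun x =>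
    ∑ i, ∑ j, ∑ k, ∑ l, (x s(i, j) - p) * ((x s(j, k) - p) * (x s(k, l) - p))
  have i4 : Integrable S4 P := hI fun x => ∑ i, ∑ j, ∑ k, ∑ l, ∑ m,
    (x s(i, j) - p) * ((x s(j, k) - p) * ((x s(k, l) - p) * (x s(l, m) - p)))
  have i5 : Integrable S5 P := hI fun x =>
    ∑ i, ∑ j, (if i = j then 0 else ∑ k, (x s(i, k) - p) * (x s(k, j) - p)) ^ 4
  have e1 : ∫ ω, S1 ω ∂P = 0 := integral_sum_entries hY hYb h0
  have e1' : ∫ ω, S1 ω ^ 2 ∂P ≤ 2 * (N : ℝ) ^ 2 := integral_sq_sum_entries_le hY hYb hYi h0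
  have e2 : ∫ ω, S2 ω ∂P = N ^ 2 * (p * (1 - p)) := integral_sum_walks_two hY hYb hYi h0 hv
  have e3 : |∫ ω, S3 ω ∂P| ≤ N ^ 2 := abs_integral_sum_walks_three_le hY hYb hYi h0
  have e4 : ∫ ω, S4 ω ∂P ≤ 4 * (N : ℝ) ^ 3 := integral_sum_walks_four_le hY hYb hYi h0
  have e5 : ∫ ω, S5 ω ∂P ≤ 3 * (N : ℝ) ^ 4 := by
    have hij (i j : Fin N) : Integrable
        (fun ω => (if i = j then 0 else ∑ k, Y s(i, k) ω * Y s(k, j) ω) ^ 4) P :=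
      hI fun x => (if i = j then 0 else ∑ k, (x s(i, k) - p) * (x s(k, j) - p)) ^ 4
    simp only [S5]
    rw [integral_finsetSum _ fun i _ => integrable_finsetSum _ fun j _ => hij i j]
    calc _ ≤ ∑ i : Fin N, ∑ j : Fin N, 3 * (N : ℝ) ^ 2 := by
          refine Finset.sum_le_sum fun i _ => ?_
          rw [integral_finsetSum _ fun j _ => hij i j]
          refine Finset.sum_le_sum fun j _ => ?_
          split_ifs with h
          · simp
          · exact integral_pow_four_codegree_le hY hYb hYi h0 h
      _ = _ := by simp; ring
  set θ := N * p
  have hθ0 : 0 < θ := by positivity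
  have hθδ : N * δ ≤ θ := mul_le_mul_of_nonneg_left hδp hN0.le
  have hpt (ω : Ω) : |l ω - θ - S1 ω / N - S2 ω / N / θ - S3 ω / N / θ ^ 2|
      ≤ 16 * (S1 ω ^ 2 / (N ^ 2 * θ) + S4 ω / (N * θ ^ 3))
        + 5 * 2 ^ 28 / δ ^ 10 * (S5 ω / N ^ 5) := by
    have := abs_principalEigenvalue_sub_expansion_le hN hδ hδp hp1 hNδ
      (W := Matrix.of fun i j => Y s(i, j) ω) (A := Matrix.of fun i j => b s(i, j) ω)
      (by ext i j; simp [Sym2.eq_swap]) (fun i j => hYb _ ω)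
      (fun i j => by simp [hYdef])
      (fun i j => by rcases h01 s(i, j) ω with h | h <;> simp [h])
    refine this.trans_eq ?_
    simp only [Matrix.of_apply, div_pow, div_div]
    rfl
  have hbd : Integrable (fun ω => 16 * (S1 ω ^ 2 / (N ^ 2 * θ) + S4 ω / (N * θ ^ 3))
      + 5 * 2 ^ 28 / δ ^ 10 * (S5 ω / N ^ 5)) P :=
    (((i1'.div_const (N ^ 2 * θ)).add (i4.div_const (N * θ ^ 3))).const_mul 16).add
      ((i5.div_const (N ^ 5 : ℝ)).const_mul (5 * 2 ^ 28 / δ ^ 10))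
  have hint : |∫ ω, (l ω - θ - S1 ω / N - S2 ω / N / θ - S3 ω / N / θ ^ 2) ∂P|
      ≤ ∫ ω, (16 * (S1 ω ^ 2 / (N ^ 2 * θ) + S4 ω / (N * θ ^ 3))
        + 5 * 2 ^ 28 / δ ^ 10 * (S5 ω / N ^ 5)) ∂P := by
    rw [← Real.norm_eq_abs]
    exact norm_integral_le_of_norm_le hbd (ae_of_all _ hpt)
  have eL : ∫ ω, (l ω - θ - S1 ω / N - S2 ω / N / θ - S3 ω / N / θ ^ 2) ∂P
      = ∫ ω, l ω ∂P - θ - (1 - p) - (∫ ω, S3 ω ∂P) / N / θ ^ 2 := by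
    have j0 := integrable_const (μ := P) θ
    have j1 := i1.div_const (N : ℝ)
    have j2 := (i2.div_const (N : ℝ)).div_const θ
    have j3 := (i3.div_const (N : ℝ)).div_const (θ ^ 2)
    rw [integral_sub ?_ j3, integral_sub ?_ j2, integral_sub ?_ j1, integral_sub il j0]
    · simp only [integral_div, e1, e2, integral_const, probReal_univ, θ]
      simp
      field_simp
    exacts [il.sub j0, (il.sub j0).sub j1, ((il.sub j0).sub j1).sub j2]
  have eR : ∫ ω, (16 * (S1 ω ^ 2 / (N ^ 2 * θ) + S4 ω / (N * θ ^ 3))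
        + 5 * 2 ^ 28 / δ ^ 10 * (S5 ω / N ^ 5)) ∂P
      = 16 * ((∫ ω, S1 ω ^ 2 ∂P) / (N ^ 2 * θ) + (∫ ω, S4 ω ∂P) / (N * θ ^ 3))
        + 5 * 2 ^ 28 / δ ^ 10 * ((∫ ω, S5 ω ∂P) / N ^ 5) := by
    have j1 := i1'.div_const ((N : ℝ) ^ 2 * θ)
    have j2 := i4.div_const ((N : ℝ) * θ ^ 3)
    have j3 := (i5.div_const ((N : ℝ) ^ 5)).const_mul (5 * 2 ^ 28 / δ ^ 10)
    rw [integral_add ?_ j3, integral_const_mul, integral_const_mul, integral_add j1 j2]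
    · simp only [integral_div]
    exact (j1.add j2).const_mul 16
  have hR : ∫ ω, (16 * (S1 ω ^ 2 / (N ^ 2 * θ) + S4 ω / (N * θ ^ 3))
        + 5 * 2 ^ 28 / δ ^ 10 * (S5 ω / N ^ 5)) ∂P
      ≤ (32 / δ + 64 / δ ^ 3 + 15 * 2 ^ 28 / δ ^ 10) / N := by
    rw [eR]
    calc _ ≤ 16 * ((2 * (N : ℝ) ^ 2) / (N ^ 2 * (N * δ)) + (4 * (N : ℝ) ^ 3) / (N * (N * δ) ^ 3))
        + 5 * 2 ^ 28 / δ ^ 10 * ((3 * (N : ℝ) ^ 4) / N ^ 5) := by gcongr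
      _ = _ := by field_simp; ring
  have h3 : |(∫ ω, S3 ω ∂P) / N / θ ^ 2| ≤ 1 / δ ^ 2 / N := by
    rw [abs_div, abs_div, Nat.abs_cast, abs_of_pos (pow_pos hθ0 2), div_div]
    calc _ ≤ (N : ℝ) ^ 2 / (N * (N * δ) ^ 2) := by gcongr
      _ = _ := by field_simp
  have hmain : |∫ ω, l ω ∂P - θ - (1 - p) - (∫ ω, S3 ω ∂P) / N / θ ^ 2|
      ≤ (32 / δ + 64 / δ ^ 3 + 15 * 2 ^ 28 / δ ^ 10) / N := by
    rw [← eL]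
    exact hint.trans hR
  have htri := abs_add_le (∫ ω, l ω ∂P - θ - (1 - p) - (∫ ω, S3 ω ∂P) / N / θ ^ 2)
    ((∫ ω, S3 ω ∂P) / N / θ ^ 2)
  rw [sub_add_cancel] at htri
  refine htri.trans ((add_le_add hmain h3).trans_eq ?_)
  rw [expansionConst]
  ring

end Bernoulli

/-! ### The edges at a fixed time are independent Bernoulli variables -/

section Model

variable {N : ℕ}

/-- The label in the `N`-vertex model of a label of the single edge of the one-vertex model, when
that edge is identified with `e`. -/
def relabel (e : Sym2 (Fin N)) : Source 1 → Source N
  | .init _ => .init e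
  | .off _ l => .off e l
  | .on _ l => .on e l

lemma relabel_injective :
    Function.Injective fun q : Sym2 (Fin N) × Source 1 => relabel q.1 q.2 := by
  rintro ⟨e, s⟩ ⟨e', s'⟩ h
  rcases s with s | ⟨s, k⟩ | ⟨s, k⟩ <;> rcases s' with s' | ⟨s', k'⟩ | ⟨s', k'⟩ <;>
    simp_all [relabel] <;> exact Subsingleton.elim _ _

lemma sourceLaw_relabel (p₀ lamOn lamOff : ℝ) (e : Sym2 (Fin N)) (s : Source 1) :
    sourceLaw p₀ lamOn lamOff (relabel e s) = sourceLaw p₀ lamOn lamOff s := by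
  cases s <;> rfl

lemma edgeState_zero_one (x : Source N → ℝ) (e : Sym2 (Fin N)) (t : ℝ) :
    edgeState x e t = 0 ∨ edgeState x e t = 1 := by
  unfold edgeState
  split_ifs <;> simp

lemma measurable_cycleTime (e : Sym2 (Fin N)) (k : ℕ) :
    Measurable fun x : Source N → ℝ => cycleTime x e k := by
  unfold cycleTime
  fun_prop

lemma measurable_edgeState (e : Sym2 (Fin N)) (t : ℝ) :
    Measurable fun x : Source N → ℝ => edgeState x e t := by
  unfold edgeState
  have hset (f : ℕ → Source N) : MeasurableSet {x : Source N → ℝ |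
      ∃ k : ℕ, t ∈ Set.Ico (cycleTime x e k) (cycleTime x e k + x (f k))} := by
    have : {x : Source N → ℝ |
        ∃ k : ℕ, t ∈ Set.Ico (cycleTime x e k) (cycleTime x e k + x (f k))}
        = ⋃ k : ℕ, {x | cycleTime x e k ≤ t} ∩ {x | t < cycleTime x e k + x (f k)} := by
      ext x; simp
    rw [this]
    refine MeasurableSet.iUnion fun k => ?_
    exact (measurableSet_le (measurable_cycleTime e k) measurable_const).inter
      (measurableSet_lt measurable_const ((measurable_cycleTime e k).add (measurable_pi_apply _)))
  refine Measurable.ite (measurableSet_eq_fun (measurable_pi_apply _) measurable_const) ?_ ?_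
  · exact Measurable.ite (hset _) measurable_const measurable_const
  · exact Measurable.ite (hset _) measurable_const measurable_const

/-- The probability that a given edge is present at time `t`. -/
noncomputable def edgeProb (p₀ lamOn lamOff t : ℝ) : ℝ :=
  (Measure.infinitePi (sourceLaw (N := 1) p₀ lamOn lamOff)).real {x | edgeState x s(0, 0) t = 1}

variable {Ω : Type*} [MeasurableSpace Ω] {P : Measure Ω} {p₀ lamOn lamOff : ℝ}
  {X : Source N → Ω → ℝ}

/-- The primitive variables of one edge have the joint law of the one-vertex model, and the edge
state is the same function of them; hence no dependence on `e` or `N`. -/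
theorem measureReal_edgeState_eq_one (hX : IsDriving p₀ lamOn lamOff P X) (e : Sym2 (Fin N))
    (t : ℝ) : P.real {ω | edgeState (fun s => X s ω) e t = 1} = edgeProb p₀ lamOn lamOff t := by
  have hinj : Function.Injective (relabel e) := fun s s' h =>
    (Prod.mk.injEq .. ▸ relabel_injective (N := N) (a₁ := (e, s)) (a₂ := (e, s')) h).2
  have hl : HasLaw (fun ω s => X (relabel e s) ω)
      (Measure.infinitePi (sourceLaw (N := 1) p₀ lamOn lamOff)) P :=
    (hX.indep.precomp hinj).hasLaw_infinitePi
      (fun s => sourceLaw_relabel p₀ lamOn lamOff e s ▸ hX.hasLaw (relabel e s))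
      (measurable_pi_lambda _ fun s => hX.measurable _).aemeasurable
  exact hl.measureReal_eq (p := fun x => edgeState x s(0, 0) t = 1)
    (measurable_edgeState _ t (measurableSet_singleton 1))

theorem iIndepFun_edgeState (hX : IsDriving p₀ lamOn lamOff P X) (t : ℝ) :
    iIndepFun (fun e ω => edgeState (fun s => X s ω) e t) P := by
  have := hX.indep.isProbabilityMeasure
  have hm (q : Sym2 (Fin N) × Source 1) : Measurable (X (relabel q.1 q.2)) := hX.measurable _
  have hprob (e : Sym2 (Fin N)) (s : Source 1) : IsProbabilityMeasure (P.map (X (relabel e s))) :=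
    Measure.isProbabilityMeasure_map (hX.measurable _).aemeasurable
  have hZ : iIndepFun (fun (e : Sym2 (Fin N)) ω s => X (relabel e s) ω) P := by
    rw [iIndepFun_iff_map_fun_eq_infinitePi_map
      (fun e => measurable_pi_lambda _ fun s => hX.measurable _)]
    have hjoint := (hX.indep.precomp (relabel_injective (N := N))).map_fun_eq_infinitePi_map hm
    -- Currying turns the product law over pairs (edge, source) into a product over edges of the
    -- laws of whole blocks, which is independence of the blocks.
    have h2 := congrArg (Measure.map (MeasurableEquiv.curry (Sym2 (Fin N)) (Source 1) ℝ)) hjoint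
    rw [Measure.map_map (MeasurableEquiv.measurable _) (measurable_pi_lambda _ hm)] at h2
    refine h2.trans ((Measure.infinitePi_map_curry
      (fun e s => P.map (X (relabel e s)))).trans ?_)
    congr 1; funext e
    have hinj : Function.Injective (relabel e) := fun s s' h =>
      (Prod.mk.injEq .. ▸ relabel_injective (N := N) (a₁ := (e, s)) (a₂ := (e, s')) h).2
    exact ((hX.indep.precomp hinj).map_fun_eq_infinitePi_map fun s => hX.measurable _).symm
  exact hZ.comp (fun _ x => edgeState x s(0, 0) t) fun _ => measurable_edgeState _ t

lemma measureReal_expMeasure_Ioi {r : ℝ} (hr : 0 < r) {T : ℝ} (hT : 0 ≤ T) :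
    (expMeasure r).real (Set.Ioi T) = Real.exp (-(r * T)) := by
  have := isProbabilityMeasure_expMeasure hr
  rw [← Set.compl_Iic, measureReal_compl measurableSet_Iic, ← cdf_eq_real, cdf_expMeasure_eq hr,
    if_pos hT]
  simp

/-- The event that the edge starts present and its first on-time exceeds `T` does not depend on `t`,
so the bound is uniform in time. -/
theorem le_edgeProb (hp₀ : 0 < p₀) (hOn : 0 < lamOn) {T t : ℝ}
    {X : Source 1 → Ω → ℝ} (hX : IsDriving p₀ lamOn lamOff P X) (ht : t ∈ Set.Icc 0 T) :
    p₀ * Real.exp (-(lamOn * T)) ≤ edgeProb p₀ lamOn lamOff t := by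
  have := hX.indep.isProbabilityMeasure
  rw [← measureReal_edgeState_eq_one hX s(0, 0) t]
  have hind : IndepFun (X (.init s(0, 0))) (X (.on s(0, 0) 0)) P := hX.indep.indepFun (by simp)
  have h1 : P.real (X (.init s(0, 0)) ⁻¹' {1}) = p₀ := by
    rw [← map_measureReal_apply (hX.measurable _) (measurableSet_singleton 1),
      (hX.hasLaw _).map_eq]
    simp [sourceLaw, measureReal_def, hp₀.le]
  have h2 : P.real (X (.on s(0, 0) 0) ⁻¹' Set.Ioi T) = Real.exp (-(lamOn * T)) := by
    rw [← map_measureReal_apply (hX.measurable _) measurableSet_Ioi, (hX.hasLaw _).map_eq]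
    exact measureReal_expMeasure_Ioi hOn (ht.1.trans ht.2)
  have h3 := hind.measure_inter_preimage_eq_mul _ _ (measurableSet_singleton 1)
    (measurableSet_Ioi (a := T))
  rw [← h1, ← h2, measureReal_def, measureReal_def, ← ENNReal.toReal_mul, ← h3]
  refine measureReal_mono fun ω hω => ?_
  have hω1 : X (.init s(0, 0)) ω = 1 := hω.1
  have hω2 : T < X (.on s(0, 0) 0) ω := hω.2
  simp only [Set.mem_ofPred_eq, edgeState, hω1, one_ne_zero, if_false]
  rw [if_pos]
  -- Cycle `0` starts at time `0`, since its `cycleTime` is an empty sum.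
  exact ⟨0, by simpa [cycleTime] using ⟨ht.1, ht.2.trans_lt hω2⟩⟩

end Model

end DynamicER

/-! ### Conclusion, uniformly in time -/

theorem theorem3p3 (p₀ lamOn lamOff T : ℝ) (hp₀ : 0 < p₀) (hp₁ : p₀ < 1)
    (hOn : 0 < lamOn) (hOff : 0 < lamOff) (hT : 0 < T)
    {Ω : ℕ → Type*} [∀ N, MeasurableSpace (Ω N)]
    (P : ∀ N, Measure (Ω N)) [∀ N, IsProbabilityMeasure (P N)]
    (X : ∀ N, DynamicER.Source N → Ω N → ℝ)
    (hX : ∀ N, DynamicER.IsDriving p₀ lamOn lamOff (P N) (X N)) :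
    ∃ p : ℝ → ℝ,
      (∀ N : ℕ, ∀ i j : Fin N, ∀ t ∈ Set.Icc 0 T,
        (P N).real {ω | DynamicER.adjacency (fun s => X N s ω) t i j = 1} = p t) ∧
      ∃ G : ℕ → ℝ → ℝ,
        (∀ N : ℕ, 1 ≤ N → ∀ t ∈ Set.Icc 0 T,
          Integrable
            (fun ω => DynamicER.principalEigenvalue (DynamicER.adjacency (fun s => X N s ω) t))
            (P N) ∧
          ∫ ω, DynamicER.principalEigenvalue (DynamicER.adjacency (fun s => X N s ω) t) ∂(P N)
            = N * p t + (1 - p t) + G N t / N) ∧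
        limsup (fun N : ℕ => ⨆ t ∈ Set.Icc 0 T, ENNReal.ofReal |G N t|) atTop < ⊤ := by
  have hm (N : ℕ) (t : ℝ) (e : Sym2 (Fin N)) :
      Measurable fun ω => DynamicER.edgeState (fun s => X N s ω) e t :=
    (DynamicER.measurable_edgeState e t).comp
      (measurable_pi_lambda _ fun s => (hX N).measurable s)
  have h01 (N : ℕ) (t : ℝ) (e : Sym2 (Fin N)) (ω : Ω N) :=
    DynamicER.edgeState_zero_one (fun s => X N s ω) e t
  refine ⟨DynamicER.edgeProb p₀ lamOn lamOff,
    fun N i j t _ => DynamicER.measureReal_edgeState_eq_one (hX N) s(i, j) t,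
    -- `G` is the rescaled remainder, so the identity is algebra and the content lies in the bound
    -- on the limsup.
    fun N t => N * (∫ ω, DynamicER.principalEigenvalue
      (DynamicER.adjacency (fun s => X N s ω) t) ∂(P N)
        - N * DynamicER.edgeProb p₀ lamOn lamOff t - (1 - DynamicER.edgeProb p₀ lamOn lamOff t)),
    fun N hN t _ => ⟨?_, ?_⟩, ?_⟩
  · exact DynamicER.integrable_comp_of_zero_one (hm N t) (h01 N t)
      fun x => DynamicER.principalEigenvalue (Matrix.of fun i j => x s(i, j))
  · have : (N : ℝ) ≠ 0 := Nat.cast_ne_zero.2 (by omega)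
    field_simp
    ring
  set δ := p₀ * Real.exp (-(lamOn * T)) with hδ
  have hδ0 : 0 < δ := by positivity
  refine lt_of_le_of_lt (limsup_le_of_le (a := ENNReal.ofReal (DynamicER.expansionConst δ))
    (h := ?_)) ENNReal.ofReal_lt_top
  obtain ⟨N₀, hN₀⟩ := exists_nat_ge (128 / δ ^ 2)
  filter_upwards [eventually_ge_atTop (max 1 N₀)] with N hN
  have hN1 : 0 < N := (le_max_left 1 N₀).trans hN
  have hNδ : 128 ≤ δ ^ 2 * N := by
    rw [div_le_iff₀' (by positivity)] at hN₀
    refine hN₀.trans ?_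
    gcongr
    exact (le_max_right 1 N₀).trans hN
  refine iSup₂_le fun t ht => ENNReal.ofReal_le_ofReal ?_
  have key := DynamicER.abs_integral_principalEigenvalue_sub_le hN1 hδ0
    (DynamicER.le_edgeProb hp₀ hOn (hX 1) ht) hNδ (hm N t)
    (DynamicER.iIndepFun_edgeState (hX N) t) (h01 N t)
    fun e => DynamicER.measureReal_edgeState_eq_one (hX N) e t
  rw [abs_mul, Nat.abs_cast, ← le_div_iff₀' (Nat.cast_pos.2 hN1)]
  exact key
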